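/- Let $q\ge 1$ be an odd integer, $m\ge 0$ an integer, and $N=q\,2^m$. The (unnormalized) $N$-point DCT-II has the matrix $C_N=\bigl[\cos\bigl(\pi(2n+1)k/(2N)\bigr)\bigr]_{k,n=0}^{N-1}$, and a real $N\times N$ matrix $\tilde C_N$ is called a scaled $N$-point DCT-II if $C_N=\Pi\,\Delta\,\tilde C_N$ with a permutation matrix $\Pi$ and a diagonal matrix $\Delta$. Transforms are computed by finite flow graphs made of additions, subtractions, shifts (multiplications by powers of two) and multiplications by real constants; only the last are counted as multiplications. Let $\tilde\mu(N)$ be the least number of multiplications with which some scaled $N$-point DCT-II can be computed. A PFA-based (prime-factor) scaled DCT-II of length $N=q\,2^m$ is a scaled $N$-point DCT-II computed by the following cascade: the input is reordered by the prime factor index map into a $2^m\times q$ array; one fixed scaled $q$-point DCT-II is applied $2^m$ times; one fixed scaled $2^m$-point DCT-II is applied $q$ times; and a last stage merges the results into the outputs. Here the prime factor index map sends sample $n$ to the position $(a,b)$, $0\le a<2^m$, $0\le b<q$, with $2n+1\equiv\pm(2a+1)\pmod{4\cdot 2^m}$ and $2n+1\equiv\pm(2b+1)\pmod{4q}$. Then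 for every scaled $q$-point DCT-II that is computed with $s$ multiplications there is a PFA-based scaled DCT-II of length $N=q\,2^m$, using it as its transform of length $q$, that requires at most $$2^m s+\tfrac52 N-q\,\frac{m(m+3)+5}{2}-2^{m-1}+\tfrac12$$ multiplications. In particular, $$\tilde\mu(N)\le 2^m\,\tilde\mu(q)+\tfrac52 N-q\,\frac{m(m+3)+5}{2}-2^{m-1}+\tfrac12 .$$ -/

import Mathlib

open Matrix
open scoped Kronecker

/-- The (unnormalized) matrix of the `N`-point DCT-II; the row index `k` is the frequency and the
column index `n` is the position of the input sample. -/
noncomputable def dct2 (N : ℕ) : Matrix (Fin N) (Fin N) ℝ :=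
  Matrix.of fun k n =>
    Real.cos (Real.pi * (2 * ((n : ℕ) : ℝ) + 1) * ((k : ℕ) : ℝ) / (2 * (N : ℝ)))

/-- `S` is a matrix of a scaled `N`-point DCT-II: the DCT-II matrix is a reordering matrix times a
diagonal matrix of scale factors times `S`. -/
def IsScaledDCT2 {N : ℕ} (S : Matrix (Fin N) (Fin N) ℝ) : Prop :=
  ∃ (σ : Equiv.Perm (Fin N)) (d : Fin N → ℝ),
    dct2 N = σ.permMatrix ℝ * Matrix.diagonal d * S

/-- `FlowGraph t V`: some finite flow graph with inputs `x i` (`i : ι`) that consists of additions,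
subtractions, shifts (multiplications by powers of two) and exactly `t` multiplications by real
constants has `V` as the set of the quantities that it computes, each of them regarded as a
function of the input `x`. -/
inductive FlowGraph {ι : Type} : ℕ → Set ((ι → ℝ) → ℝ) → Prop
  | input : FlowGraph 0 (Set.range fun (i : ι) (x : ι → ℝ) => x i)
  | add {t : ℕ} {V : Set ((ι → ℝ) → ℝ)} {u v : (ι → ℝ) → ℝ} (h : FlowGraph t V)
      (hu : u ∈ V) (hv : v ∈ V) : FlowGraph t (insert (fun x => u x + v x) V)
  | sub {t : ℕ} {V : Set ((ι → ℝ) → ℝ)} {u v : (ι → ℝ) → ℝ} (h : FlowGraph t V)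
      (hu : u ∈ V) (hv : v ∈ V) : FlowGraph t (insert (fun x => u x - v x) V)
  | shift {t : ℕ} {V : Set ((ι → ℝ) → ℝ)} {u : (ι → ℝ) → ℝ} (k : ℤ) (h : FlowGraph t V)
      (hu : u ∈ V) : FlowGraph t (insert (fun x => (2 : ℝ) ^ k * u x) V)
  | mul {t : ℕ} {V : Set ((ι → ℝ) → ℝ)} {u : (ι → ℝ) → ℝ} (c : ℝ) (h : FlowGraph t V)
      (hu : u ∈ V) : FlowGraph (t + 1) (insert (fun x => c * u x) V)

/-- The transform `x ↦ M x` is computed by a flow graph with exactly `t` multiplications. -/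
def ComputesWith {κ ι : Type} [Fintype ι] (M : Matrix κ ι ℝ) (t : ℕ) : Prop :=
  ∃ V : Set ((ι → ℝ) → ℝ), FlowGraph t V ∧ ∀ k : κ, (fun x => (M *ᵥ x) k) ∈ V

/-- The multiplicative complexity of the scaled `N`-point DCT-II: the least number of
multiplications in a flow graph that computes some scaled `N`-point DCT-II. -/
noncomputable def scaledMulComplexity (N : ℕ) : ℕ :=
  sInf {t : ℕ | ∃ S : Matrix (Fin N) (Fin N) ℝ, IsScaledDCT2 S ∧ ComputesWith S t}

/-- The input reordering of the prime factor algorithm for the DCT-II of length `q * p`: sample `n`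
goes to the position `(a, b)` with `2 n + 1 ≡ ± (2 a + 1)` modulo `4 p` and
`2 n + 1 ≡ ± (2 b + 1)` modulo `4 q`, so that `cos (π (2 n + 1) i / (2 p))` is
`cos (π (2 a + 1) i / (2 p))` for all integers `i`, and likewise for `q` and `b`. -/
def IsPrimeFactorMap {p q : ℕ} (e : Fin (q * p) ≃ Fin p × Fin q) : Prop :=
  ∀ n : Fin (q * p),
    ((2 * ((n : ℕ) : ℤ) + 1 ≡ 2 * (((e n).1 : ℕ) : ℤ) + 1 [ZMOD 4 * (p : ℤ)]) ∨
      (2 * ((n : ℕ) : ℤ) + 1 ≡ -(2 * (((e n).1 : ℕ) : ℤ) + 1) [ZMOD 4 * (p : ℤ)])) ∧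
    ((2 * ((n : ℕ) : ℤ) + 1 ≡ 2 * (((e n).2 : ℕ) : ℤ) + 1 [ZMOD 4 * (q : ℤ)]) ∨
      (2 * ((n : ℕ) : ℤ) + 1 ≡ -(2 * (((e n).2 : ℕ) : ℤ) + 1) [ZMOD 4 * (q : ℤ)]))

/-- A prime-factor (PFA) factorization of a scaled DCT-II of length `q * p`: the input is reordered
into a `p × q` array, a scaled `q`-point DCT-II is applied `p` times along one direction, a scaled
`p`-point DCT-II is applied `q` times along the other one, and a last stage merges the results into
the outputs of a scaled DCT-II of length `q * p`. -/
structure ScaledPFA (q p : ℕ) where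
  /-- the reordering of the input -/
  split : Fin (q * p) ≃ Fin p × Fin q
  split_spec : IsPrimeFactorMap split
  /-- the scaled transform of length `q` -/
  Sq : Matrix (Fin q) (Fin q) ℝ
  Sq_scaled : IsScaledDCT2 Sq
  /-- the scaled transform of length `p` -/
  Sp : Matrix (Fin p) (Fin p) ℝ
  Sp_scaled : IsScaledDCT2 Sp
  /-- the last stage -/
  merge : Matrix (Fin (q * p)) (Fin p × Fin q) ℝ
  result_scaled : IsScaledDCT2
    ((merge * ((Sp ⊗ₖ (1 : Matrix (Fin q) (Fin q) ℝ)) *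
      ((1 : Matrix (Fin p) (Fin p) ℝ) ⊗ₖ Sq))).submatrix id split)

/-- The scaled DCT-II matrix of length `q * p` that the factorization produces. -/
def ScaledPFA.matrix {q p : ℕ} (A : ScaledPFA q p) : Matrix (Fin (q * p)) (Fin (q * p)) ℝ :=
  (A.merge * ((A.Sp ⊗ₖ (1 : Matrix (Fin q) (Fin q) ℝ)) *
    ((1 : Matrix (Fin p) (Fin p) ℝ) ⊗ₖ A.Sq))).submatrix id A.split

/-- The cascade uses `t` multiplications, when its `p` transforms of length `q`, its `q` transforms
of length `p` and its last stage are computed one after the other, each by a flow graph of its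
own, the one for length `q` having `s` multiplications. -/
def ScaledPFA.UsesMul {q p : ℕ} (A : ScaledPFA q p) (s t : ℕ) : Prop :=
  ∃ a c : ℕ, ComputesWith A.Sq s ∧ ComputesWith A.Sp a ∧ ComputesWith A.merge c ∧
    t = p * s + q * a + c

/-- Any linear form can be added to the quantities that a flow graph computes. -/
theorem FlowGraph.exists_form {ι : Type} [Fintype ι] [Nonempty ι] {t : ℕ}
    {V : Set ((ι → ℝ) → ℝ)} (h : FlowGraph t V)
    (hV : ∀ i : ι, (fun x : ι → ℝ => x i) ∈ V) (w : ι → ℝ) (s : Finset ι) :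
    ∃ (t' : ℕ) (V' : Set ((ι → ℝ) → ℝ)), FlowGraph t' V' ∧ V ⊆ V' ∧
      (fun x => ∑ i ∈ s, w i * x i) ∈ V' := by
  classical
  induction s using Finset.induction_on with
  | empty =>
    refine ⟨_, _, FlowGraph.mul 0 h (hV (Classical.arbitrary ι)), Set.subset_insert _ _, ?_⟩
    simp
  | insert a s ha ih =>
    obtain ⟨t', V', h', hs, hm⟩ := ih
    have h2 := FlowGraph.mul (w a) h' (hs (hV a))
    have h3 := FlowGraph.add h2 (Set.mem_insert _ _) (Set.mem_insert_of_mem _ hm)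
    refine ⟨_, _, h3,
      (hs.trans (Set.subset_insert _ _)).trans (Set.subset_insert _ _), ?_⟩
    left
    funext x
    rw [Finset.sum_insert ha]

/-- Every matrix is computed by some flow graph. -/
theorem exists_computesWith {κ ι : Type} [Fintype κ] [Fintype ι] [Nonempty ι]
    (M : Matrix κ ι ℝ) : ∃ t, ComputesWith M t := by
  classical
  have key : ∀ s : Finset κ, ∃ (t : ℕ) (V : Set ((ι → ℝ) → ℝ)), FlowGraph t V ∧
      (∀ i : ι, (fun x : ι → ℝ => x i) ∈ V) ∧ ∀ k ∈ s, (fun x => (M *ᵥ x) k) ∈ V := by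
    intro s
    induction s using Finset.induction_on with
    | empty => exact ⟨_, _, FlowGraph.input, fun i => ⟨i, rfl⟩, by simp⟩
    | insert a s ha ih =>
      obtain ⟨t, V, h, hV, hs⟩ := ih
      obtain ⟨t', V', h', hsub, hm⟩ := h.exists_form hV (M a) Finset.univ
      refine ⟨t', V', h', fun i => hsub (hV i), fun k hk => ?_⟩
      rcases Finset.mem_insert.1 hk with rfl | hk
      · exact hm
      · exact hsub (hs k hk)
  obtain ⟨t, V, h, -, hs⟩ := key Finset.univ
  exact ⟨t, V, h, fun k => hs k (Finset.mem_univ k)⟩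

/-- The minimum that defines `scaledMulComplexity` is attained. -/
theorem scaledMulComplexity_spec (N : ℕ) (hN : 0 < N) :
    ∃ S : Matrix (Fin N) (Fin N) ℝ, IsScaledDCT2 S ∧ ComputesWith S (scaledMulComplexity N) := by
  have : Nonempty (Fin N) := ⟨⟨0, hN⟩⟩
  obtain ⟨t, ht⟩ := exists_computesWith (dct2 N)
  exact Nat.sInf_mem
    (s := {t : ℕ | ∃ S : Matrix (Fin N) (Fin N) ℝ, IsScaledDCT2 S ∧ ComputesWith S t})
    ⟨t, dct2 N, ⟨1, 1, by ext i j; simp⟩, ht⟩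

/-! The cost splits as `p * s + q * a + c` with `p = 2 ^ m`, so one needs a cheap scaled DCT-II of
length `2 ^ m` and a cheap merging stage.

Length `2 ^ m`: additions and shifts make integral matrices free, and a common denominator can be
absorbed into the diagonal scaling, so it suffices to write some scaled DCT-II as a rational matrix
plus few real multiples of rational rank-one matrices. Dividing row `k` by `cos (π k / (2 N))`
reduces it to the matrix `cos (π k j / 2 ^ m)` (`cos_odd_mul_eq_sum`). Splitting `k` and then `j` by
parity leaves blocks with both indices odd. Odd numbers are `± 5 ^ a` modulo a power of two, so
these blocks are Hankel up to signs, and interpolation bounds their rank by `2 ^ (r + 1) - 1`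
(`hasRationalRank_hankel`). Summing gives `scaledDCT2Rank`.

Merging: an output is a product of a length-`p` and a length-`q` cosine, or a sum or difference of
two such products (`exists_prime_factor_index`, `cos_add_eq_sub_complement`). After rescaling, only
one term carries a constant, and this constant is the same for the sum and the difference. This
costs `(p - 1) * (q - 1) / 2` multiplications (`exists_merge`). -/

/-- `L` is a rational matrix plus a real linear combination of `t` rational matrices of rank at
most one. -/
def HasRationalRank {κ ι : Type} (L : κ → ι → ℝ) (t : ℕ) : Prop :=
  ∃ (R : κ → ι → ℚ) (g : Fin t → ℝ) (c : Fin t → κ → ℚ) (a : Fin t → ι → ℚ),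
    ∀ i j, L i j = R i j + ∑ r, g r * c r i * a r j

namespace HasRationalRank

variable {κ ι : Type} {L L' : κ → ι → ℝ} {t t' : ℕ}

theorem of_rat (R : κ → ι → ℚ) : HasRationalRank (fun i j => (R i j : ℝ)) 0 :=
  ⟨R, fun _ => 0, fun _ _ => 0, fun _ _ => 0, by simp⟩

theorem add (h : HasRationalRank L t) (h' : HasRationalRank L' t') :
    HasRationalRank (fun i j => L i j + L' i j) (t + t') := by
  obtain ⟨R, g, c, a, h⟩ := h
  obtain ⟨R', g', c', a', h'⟩ := h'
  refine ⟨fun i j => R i j + R' i j, Fin.append g g', Fin.append c c', Fin.append a a',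
    fun i j => ?_⟩
  simp only [Fin.sum_univ_add, Fin.append_left, Fin.append_right, h, h']
  push_cast
  ring

theorem scale (h : HasRationalRank L t) (u : κ → ℚ) (w : ι → ℚ) :
    HasRationalRank (fun i j => u i * L i j * w j) t := by
  obtain ⟨R, g, c, a, h⟩ := h
  refine ⟨fun i j => u i * R i j * w j, g, fun r i => u i * c r i, fun r j => a r j * w j,
    fun i j => ?_⟩
  dsimp only
  rw [h, mul_add, add_mul, Finset.mul_sum, Finset.sum_mul]
  push_cast
  congr 1
  exact Finset.sum_congr rfl fun r _ => by ring

theorem mul_rat {μ : Type} [Fintype ι] (h : HasRationalRank L t) (U : ι → μ → ℚ) :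
    HasRationalRank (fun i j => ∑ l, L i l * U l j) t := by
  obtain ⟨R, g, c, a, h⟩ := h
  refine ⟨fun i j => ∑ l, R i l * U l j, g, c, fun r j => ∑ l, a r l * U l j, fun i j => ?_⟩
  push_cast
  simp only [h, add_mul, Finset.sum_add_distrib, Finset.sum_mul, Finset.mul_sum]
  congr 1
  rw [Finset.sum_comm]
  exact Finset.sum_congr rfl fun r _ => Finset.sum_congr rfl fun l _ => by ring

end HasRationalRank

/-! ### Hankel matrices by interpolation -/

/-- Every finite sequence of length `N` is a combination of the sequences `l ↦ r ^ l`, `r < N`. -/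
theorem exists_sum_mul_pow (N : ℕ) (h : ℕ → ℝ) :
    ∃ g : Fin N → ℝ, ∀ l < N, h l = ∑ r : Fin N, g r * ((r : ℕ) : ℝ) ^ l := by
  let V : Matrix (Fin N) (Fin N) ℝ := Matrix.vandermonde fun r => ((r : ℕ) : ℝ)
  have hV : IsUnit V.det := by
    rw [isUnit_iff_ne_zero, Matrix.det_vandermonde_ne_zero_iff]
    intro r s hrs
    exact Fin.ext (Nat.cast_injective hrs)
  refine ⟨(fun l : Fin N => h l) ᵥ* V⁻¹, fun l hl => ?_⟩
  have := congrFun (show ((fun l : Fin N => h l) ᵥ* V⁻¹) ᵥ* V = fun l : Fin N => h l by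
    rw [Matrix.vecMul_vecMul, Matrix.nonsing_inv_mul _ hV, Matrix.vecMul_one]) ⟨l, hl⟩
  rw [← this]
  simp [Matrix.vecMul, dotProduct, V, Matrix.vandermonde_apply]

/-- Matrices that are of Hankel type up to signs have small rational rank (Toom-Cook). -/
theorem hasRationalRank_hankel {κ ι : Type} {n n' : ℕ} (h : ℕ → ℝ) (a : κ → ℕ) (b : ι → ℕ)
    (ha : ∀ i, a i < n) (hb : ∀ j, b j < n') (s : κ → ℚ) (s' : ι → ℚ) :
    HasRationalRank (fun i j => s i * s' j * h (a i + b j)) (n + n' - 1) := by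
  obtain ⟨g, hg⟩ := exists_sum_mul_pow (n + n' - 1) h
  refine ⟨fun _ _ => 0, g, fun r i => s i * (r : ℕ) ^ a i, fun r j => s' j * (r : ℕ) ^ b j,
    fun i j => ?_⟩
  dsimp only
  -- The index `a i + b j` takes at most `n + n' - 1` values, and `r ^ (a i + b j)` factors into a
  -- row part and a column part.
  rw [hg _ (by have := ha i; have := hb j; omega), Finset.mul_sum]
  push_cast
  rw [zero_add]
  exact Finset.sum_congr rfl fun r _ => by ring

/-! ### Cosine matrices for powers of two -/

/-- The oddness of the cofactor is what matters: multiplying by this power of `5` flips bit `r + 2`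
of an odd number and keeps the lower ones. -/
theorem five_pow_two_pow (r : ℕ) : ∃ w : ℤ, (5 : ℤ) ^ 2 ^ r = 1 + 2 ^ (r + 2) * (2 * w + 1) := by
  induction r with
  | zero => exact ⟨0, by norm_num⟩
  | succ r ih =>
    obtain ⟨w, hw⟩ := ih
    refine ⟨w + 2 ^ r * (2 * w + 1) ^ 2, ?_⟩
    rw [pow_succ, pow_mul, hw]
    ring

theorem exists_five_pow {u : ℤ} (hu : ∃ v, u = 4 * v + 1) (r : ℕ) :
    ∃ a < 2 ^ r, ∃ t : ℤ, u = 5 ^ a + 2 ^ (r + 2) * t := by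
  induction r with
  | zero =>
    obtain ⟨v, rfl⟩ := hu
    exact ⟨0, by norm_num, v, by ring⟩
  | succ r ih =>
    obtain ⟨a, ha, t, rfl⟩ := ih
    rcases Int.even_or_odd' t with ⟨v, rfl | rfl⟩
    · exact ⟨a, by rw [pow_succ]; omega, v, by ring⟩
    · obtain ⟨w, hw⟩ := five_pow_two_pow r
      obtain ⟨z, hz⟩ : ∃ z : ℤ, (5 : ℤ) ^ a = 2 * z + 1 := (show Odd (5 : ℤ) by decide).pow
      refine ⟨a + 2 ^ r, by rw [pow_succ]; omega, v - (2 * z * w + z + w), ?_⟩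
      rw [pow_add (5 : ℤ), hw, hz]
      ring

/-- Up to sign, odd numbers are powers of `5` modulo powers of two. -/
theorem exists_cos_eq_five_pow (r : ℕ) (k : ℤ) : ∃ a < 2 ^ r, ∃ s : ℚ, ∀ w : ℤ, Odd w →
    Real.cos ((2 * k + 1 : ℤ) * w * (Real.pi / 2 ^ (r + 2))) =
      s * Real.cos (5 ^ a * w * (Real.pi / 2 ^ (r + 2))) := by
  have key : ∀ u : ℤ, (∃ v, u = 4 * v + 1) → ∃ a < 2 ^ r, ∃ s : ℚ, ∀ w : ℤ, Odd w →
      Real.cos (u * w * (Real.pi / 2 ^ (r + 2))) =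
        s * Real.cos (5 ^ a * w * (Real.pi / 2 ^ (r + 2))) := by
    intro u hu
    obtain ⟨a, ha, t, rfl⟩ := exists_five_pow hu r
    -- The angle changes by `t * w * π`; as `w` is odd, the sign `(-1) ^ t` does not depend on `w`.
    refine ⟨a, ha, (-1) ^ t, fun w hw => ?_⟩
    have h1 : ((5 ^ a + 2 ^ (r + 2) * t : ℤ) : ℝ) * w * (Real.pi / 2 ^ (r + 2)) =
        5 ^ a * w * (Real.pi / 2 ^ (r + 2)) + (t * w : ℤ) * Real.pi := by
      push_cast
      field_simp
    rw [h1, Real.cos_add_int_mul_pi, mul_comm t w, _root_.zpow_mul, hw.neg_one_zpow]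
    push_cast
    rfl
  -- One of `± (2 k + 1)` is `1` modulo `4`, and the cosine is even.
  rcases Int.even_or_odd' k with ⟨v, rfl | rfl⟩
  · exact key _ ⟨v, by ring⟩
  · obtain ⟨a, ha, s, h⟩ := key (-(2 * (2 * v + 1) + 1)) ⟨-v - 1, by ring⟩
    refine ⟨a, ha, s, fun w hw => ?_⟩
    rw [← h w hw, ← Real.cos_neg]
    congr 1
    push_cast
    ring

/-- Writing both odd factors as signed powers of `5` turns their product into `5 ^ (a + b)`, so the
matrix has Hankel type with `2 ^ r` exponents on each side. -/
theorem hasRationalRank_cos_odd_odd {κ ι : Type} (k : κ → ℤ) (j : ι → ℤ) (r : ℕ) :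
    HasRationalRank (fun x y => Real.cos (((2 * k x + 1 : ℤ) : ℝ) * ((2 * j y + 1 : ℤ) : ℝ) *
      (Real.pi / 2 ^ (r + 2)))) (2 ^ (r + 1) - 1) := by
  choose a ha s hs using fun x => exists_cos_eq_five_pow r (k x)
  choose b hb s' hs' using fun y => exists_cos_eq_five_pow r (j y)
  have h := hasRationalRank_hankel (fun l => Real.cos (5 ^ l * (Real.pi / 2 ^ (r + 2)))) a b ha hb
    s s'
  rw [show 2 ^ r + 2 ^ r - 1 = 2 ^ (r + 1) - 1 by rw [pow_succ]; omega] at h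
  convert h using 3 with x y
  rw [hs x _ ⟨j y, rfl⟩, mul_comm ((5 : ℝ) ^ a x)]
  have := hs' y (5 ^ a x) ((show Odd (5 : ℤ) by decide).pow)
  push_cast at this ⊢
  rw [this, pow_add, mul_comm ((5 : ℝ) ^ b y)]
  ring_nf

/-- The number of multiplications used for the transforms `cos (π j (2 k + 1) / 2 ^ (r + 1))`. -/
def dct3Rank : ℕ → ℕ
  | 0 => 0
  | r + 1 => dct3Rank r + (2 ^ (r + 1) - 1)

/-- The number of multiplications used for the scaled DCT-II of length `2 ^ m`. -/
def scaledDCT2Rank : ℕ → ℕ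
  | 0 => 0
  | m + 1 => scaledDCT2Rank m + dct3Rank m

theorem dct3Rank_eq (r : ℕ) : (dct3Rank r : ℝ) = 2 * 2 ^ r - 2 - r := by
  induction r with
  | zero => norm_num [dct3Rank]
  | succ r ih =>
    rw [dct3Rank, Nat.cast_add, ih, Nat.cast_sub Nat.one_le_two_pow]
    push_cast
    ring

theorem scaledDCT2Rank_eq (m : ℕ) :
    (scaledDCT2Rank m : ℝ) = 2 * 2 ^ m - (m * (m + 3) + 4) / 2 := by
  induction m with
  | zero => norm_num [scaledDCT2Rank]
  | succ m ih =>
    rw [scaledDCT2Rank, Nat.cast_add, ih, dct3Rank_eq]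
    push_cast
    ring

theorem exists_rat_cos_int_mul_pi_div_two (n : ℤ) : ∃ c : ℚ, (c : ℝ) = Real.cos (n * Real.pi / 2) := by
  rcases Int.even_or_odd' n with ⟨v, rfl | rfl⟩
  · refine ⟨(-1) ^ v, ?_⟩
    rw [show ((2 * v : ℤ) : ℝ) * Real.pi / 2 = v * Real.pi by push_cast; ring,
      Real.cos_int_mul_pi]
    push_cast
    rfl
  · refine ⟨0, ?_⟩
    rw [eq_comm, Rat.cast_zero, Real.cos_eq_zero_iff]
    exact ⟨v, by push_cast; ring⟩

/-- Columns with even `j` halve the denominator and go to the induction; those with odd `j` form the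
Hankel block. The indicator weights join the two parts. -/
theorem hasRationalRank_cos_odd {κ ι : Type} (k : κ → ℤ) (r : ℕ) (j : ι → ℤ) :
    HasRationalRank (fun x y => Real.cos (((2 * k x + 1 : ℤ) : ℝ) * (j y : ℝ) *
      (Real.pi / 2 ^ (r + 1)))) (dct3Rank r) := by
  induction r generalizing j with
  | zero =>
    rw [dct3Rank]
    choose c hc using exists_rat_cos_int_mul_pi_div_two
    convert HasRationalRank.of_rat (fun x y => c ((2 * k x + 1) * j y)) using 1
    funext x y
    rw [hc]
    push_cast
    ring_nf
  | succ r ih =>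
    have h := ((ih fun y => j y / 2).scale 1 (fun y => if Even (j y) then 1 else 0)).add
      ((hasRationalRank_cos_odd_odd k (fun y => j y / 2) r).scale 1
        (fun y => if Even (j y) then 0 else 1))
    rw [dct3Rank]
    convert h using 1
    funext x y
    rcases Int.even_or_odd' (j y) with ⟨v, hv | hv⟩
    · have h1 : Even (j y) := by simp [hv]
      simp only [h1, if_true, Pi.one_apply]
      rw [show j y / 2 = v by omega, hv]
      push_cast
      simp only [one_mul, mul_one, mul_zero, add_zero]
      congr 1
      field_simp
      ring
    · have h1 : ¬ Even (j y) := by rw [Int.not_even_iff_odd]; exact ⟨v, hv⟩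
      simp only [h1, if_false, Pi.one_apply]
      rw [show j y / 2 = v by omega, hv]
      simp

/-- The same parity splitting, now on the rows. -/
theorem hasRationalRank_cos {κ ι : Type} (m : ℕ) (k : κ → ℤ) (j : ι → ℤ) :
    HasRationalRank (fun x y => Real.cos ((k x : ℝ) * (j y : ℝ) * (Real.pi / 2 ^ m)))
      (scaledDCT2Rank m) := by
  induction m generalizing k with
  | zero =>
    rw [scaledDCT2Rank]
    convert HasRationalRank.of_rat (fun x y => (-1 : ℚ) ^ (k x * j y)) using 1
    funext x y
    rw [show (k x : ℝ) * j y * (Real.pi / 2 ^ 0) = (k x * j y : ℤ) * Real.pi by push_cast; ring,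
      Real.cos_int_mul_pi]
    push_cast
    rfl
  | succ m ih =>
    have h := ((ih fun x => k x / 2).scale (fun x => if Even (k x) then 1 else 0) 1).add
      ((hasRationalRank_cos_odd (fun x => k x / 2) m j).scale
        (fun x => if Even (k x) then 0 else 1) 1)
    rw [scaledDCT2Rank]
    convert h using 1
    funext x y
    rcases Int.even_or_odd' (k x) with ⟨v, hv | hv⟩
    · have h1 : Even (k x) := by simp [hv]
      simp only [h1, if_true, Pi.one_apply]
      rw [show k x / 2 = v by omega, hv]
      push_cast
      simp only [one_mul, mul_one, zero_mul, add_zero]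
      congr 1
      field_simp
      ring
    · have h1 : ¬ Even (k x) := by rw [Int.not_even_iff_odd]; exact ⟨v, hv⟩
      simp only [h1, if_false, Pi.one_apply]
      rw [show k x / 2 = v by omega, hv]
      simp

/-- `cos ((2 n + 1) φ) / cos φ` is an integral combination of the numbers `cos (2 j φ)`. -/
theorem cos_odd_mul_eq_sum (φ : ℝ) (n : ℕ) : Real.cos ((2 * n + 1) * φ) =
    Real.cos φ * ∑ j ∈ Finset.range (n + 1),
      Real.cos (2 * j * φ) * (if j = 0 then (-1) ^ n else 2 * (-1) ^ (n - j)) := by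
  induction n with
  | zero => simp
  | succ n ih =>
    have h1 : Real.cos ((2 * (n + 1 : ℕ) + 1) * φ) =
        2 * Real.cos φ * Real.cos (2 * (n + 1 : ℕ) * φ) - Real.cos ((2 * n + 1) * φ) := by
      have ha := Real.cos_add (2 * (n + 1 : ℕ) * φ) φ
      have hb := Real.cos_sub (2 * (n + 1 : ℕ) * φ) φ
      rw [show (2 * (n + 1 : ℕ) : ℝ) * φ + φ = (2 * (n + 1 : ℕ) + 1) * φ by ring] at ha
      rw [show (2 * (n + 1 : ℕ) : ℝ) * φ - φ = (2 * n + 1) * φ by push_cast; ring] at hb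
      linarith
    rw [h1, ih, Finset.sum_range_succ _ (n + 1)]
    have h2 : ∑ j ∈ Finset.range (n + 1), Real.cos (2 * j * φ) *
        (if j = 0 then (-1) ^ (n + 1) else 2 * (-1) ^ (n + 1 - j)) =
        -∑ j ∈ Finset.range (n + 1), Real.cos (2 * j * φ) *
        (if j = 0 then (-1) ^ n else 2 * (-1) ^ (n - j)) := by
      rw [← Finset.sum_neg_distrib]
      refine Finset.sum_congr rfl fun j hj => ?_
      rw [Nat.succ_sub (by simpa [Nat.lt_succ_iff] using hj)]
      split_ifs <;> rw [pow_succ] <;> ring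
    rw [h2]
    simp
    ring

theorem cos_dct2_phase_pos {N : ℕ} (k : Fin N) :
    0 < Real.cos ((k : ℕ) * (Real.pi / (2 * N))) := by
  have hk : ((k : ℕ) : ℝ) < N := by exact_mod_cast k.2
  have hN : (0 : ℝ) < N := lt_of_le_of_lt (Nat.cast_nonneg _) hk
  apply Real.cos_pos_of_mem_Ioo
  constructor
  · have : 0 ≤ (k : ℕ) * (Real.pi / (2 * N)) := by positivity
    linarith [Real.pi_pos]
  · rw [show Real.pi / 2 = N * (Real.pi / (2 * N)) by field_simp]
    have : 0 < Real.pi / (2 * N) := by positivity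
    gcongr

/-- With `φ = π k / (2 * 2 ^ m)` the factor `cos φ` depends on the row only, and `2 j φ = π k j / 2
^ m`; the remaining coefficients are integers. -/
theorem exists_isScaledDCT2_hasRationalRank (m : ℕ) :
    ∃ S : Matrix (Fin (2 ^ m)) (Fin (2 ^ m)) ℝ, (∃ d : Fin (2 ^ m) → ℝ,
      ∀ k n, dct2 (2 ^ m) k n = d k * S k n) ∧ HasRationalRank S (scaledDCT2Rank m) := by
  have h := (hasRationalRank_cos m (fun k : Fin (2 ^ m) => ((k : ℕ) : ℤ))
    (fun j : Fin (2 ^ m) => ((j : ℕ) : ℤ))).mul_rat (fun j n : Fin (2 ^ m) =>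
      if (j : ℕ) ∈ Finset.range ((n : ℕ) + 1) then
        (if (j : ℕ) = 0 then (-1) ^ (n : ℕ) else 2 * (-1) ^ ((n : ℕ) - j)) else 0)
  refine ⟨_, ⟨fun k => Real.cos ((k : ℕ) * (Real.pi / (2 * (2 ^ m : ℕ)))), fun k n => ?_⟩, h⟩
  have h1 := cos_odd_mul_eq_sum ((k : ℕ) * (Real.pi / (2 * (2 ^ m : ℕ)))) n
  rw [dct2, Matrix.of_apply]
  convert h1 using 2
  · push_cast
    ring
  · rw [Fin.sum_univ_eq_sum_range (fun j : ℕ => Real.cos ((((k : ℕ) : ℤ) : ℝ) * ((j : ℤ) : ℝ) *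
      (Real.pi / 2 ^ m)) * ((if j ∈ Finset.range ((n : ℕ) + 1) then
        (if j = 0 then (-1) ^ (n : ℕ) else 2 * (-1) ^ ((n : ℕ) - j)) else 0 : ℚ) : ℝ)) (2 ^ m)]
    have hs : Finset.range ((n : ℕ) + 1) ⊆ Finset.range (2 ^ m) :=
      Finset.range_subset_range.2 n.2
    rw [← Finset.sum_subset hs]
    · refine Finset.sum_congr rfl fun j hj => ?_
      rw [if_pos hj]
      congr 1
      · congr 1
        push_cast
        field_simp
      · split_ifs <;> push_cast <;> rfl
    · intro j _ hj
      rw [if_neg hj]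
      simp

/-! ### Composition of flow graphs -/

namespace FlowGraph

variable {ι κ : Type} {t s : ℕ} {V : Set ((ι → ℝ) → ℝ)}

/-- Inserting a flow graph: its inputs are replaced with quantities that are already computed. -/
theorem exists_subst {W : Set ((κ → ℝ) → ℝ)} (hW : FlowGraph s W) (h : FlowGraph t V)
    (y : κ → (ι → ℝ) → ℝ) (hy : ∀ k, y k ∈ V) :
    ∃ V', V ⊆ V' ∧ FlowGraph (t + s) V' ∧ ∀ w ∈ W, (fun x => w fun k => y k x) ∈ V' := by
  induction hW with
  | input => exact ⟨V, subset_rfl, h, by rintro _ ⟨k, rfl⟩; exact hy k⟩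
  | add _ hu hv ih =>
    obtain ⟨V', hV, h', hm⟩ := ih
    refine ⟨_, hV.trans (Set.subset_insert _ _), h'.add (hm _ hu) (hm _ hv), ?_⟩
    rintro w (rfl | hw)
    exacts [Set.mem_insert _ _, Set.mem_insert_of_mem _ (hm _ hw)]
  | sub _ hu hv ih =>
    obtain ⟨V', hV, h', hm⟩ := ih
    refine ⟨_, hV.trans (Set.subset_insert _ _), h'.sub (hm _ hu) (hm _ hv), ?_⟩
    rintro w (rfl | hw)
    exacts [Set.mem_insert _ _, Set.mem_insert_of_mem _ (hm _ hw)]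
  | shift k _ hu ih =>
    obtain ⟨V', hV, h', hm⟩ := ih
    refine ⟨_, hV.trans (Set.subset_insert _ _), h'.shift k (hm _ hu), ?_⟩
    rintro w (rfl | hw)
    exacts [Set.mem_insert _ _, Set.mem_insert_of_mem _ (hm _ hw)]
  | mul c _ hu ih =>
    obtain ⟨V', hV, h', hm⟩ := ih
    refine ⟨_, hV.trans (Set.subset_insert _ _), h'.mul c (hm _ hu), ?_⟩
    rintro w (rfl | hw)
    exacts [Set.mem_insert _ _, Set.mem_insert_of_mem _ (hm _ hw)]

/-- Performing one extension of a flow graph for each element of a finite type. -/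
theorem exists_forall [Fintype κ] {Q : κ → Set ((ι → ℝ) → ℝ) → Prop}
    (mono : ∀ k V₁ V₂, V₁ ⊆ V₂ → Q k V₁ → Q k V₂)
    (step : ∀ k t' V', V ⊆ V' → FlowGraph t' V' →
      ∃ V'', V' ⊆ V'' ∧ FlowGraph (t' + s) V'' ∧ Q k V'')
    (h : FlowGraph t V) :
    ∃ V', V ⊆ V' ∧ FlowGraph (t + Fintype.card κ * s) V' ∧ ∀ k, Q k V' := by
  classical
  have key : ∀ F : Finset κ, ∃ V', V ⊆ V' ∧ FlowGraph (t + F.card * s) V' ∧ ∀ k ∈ F, Q k V' := by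
    intro F
    induction F using Finset.induction_on with
    | empty => exact ⟨V, subset_rfl, by simpa using h, by simp⟩
    | insert a F ha ih =>
      obtain ⟨V', hV, h', hQ⟩ := ih
      obtain ⟨V'', hV', h'', hQ'⟩ := step a _ V' hV h'
      refine ⟨V'', hV.trans hV', ?_, fun k hk => ?_⟩
      · rw [Finset.card_insert_of_notMem ha, add_mul, one_mul, ← add_assoc]
        exact h''
      · rcases Finset.mem_insert.1 hk with rfl | hk
        exacts [hQ', mono _ _ _ hV' (hQ k hk)]
  obtain ⟨V', hV, h', hQ⟩ := key Finset.univ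
  exact ⟨V', hV, h', fun k => hQ k (Finset.mem_univ k)⟩

/-- Sums and negatives cost no multiplication. Zero is obtained as `u - u`, which is why `V` must be
nonempty. -/
theorem exists_mem_of_mem_closure (hne : V.Nonempty) {w : (ι → ℝ) → ℝ}
    (hw : w ∈ AddSubgroup.closure V) : ∀ (t' : ℕ) (V' : Set ((ι → ℝ) → ℝ)), V ⊆ V' →
      FlowGraph t' V' → ∃ V'', V' ⊆ V'' ∧ FlowGraph t' V'' ∧ w ∈ V'' := by
  obtain ⟨u, hu⟩ := hne
  have h0 : ∀ (t' : ℕ) (V' : Set ((ι → ℝ) → ℝ)), V ⊆ V' → FlowGraph t' V' →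
      ∃ V'', V' ⊆ V'' ∧ FlowGraph t' V'' ∧ (0 : (ι → ℝ) → ℝ) ∈ V'' := by
    intro t' V' hV h
    refine ⟨_, Set.subset_insert _ _, h.sub (hV hu) (hV hu), ?_⟩
    left
    funext x
    simp
  induction hw using AddSubgroup.closure_induction with
  | mem w hw => exact fun t' V' hV h => ⟨V', subset_rfl, h, hV hw⟩
  | zero => exact h0
  | add w₁ w₂ _ _ ih₁ ih₂ =>
    intro t' V' hV h
    obtain ⟨V₁, hV₁, h₁, hw₁⟩ := ih₁ t' V' hV h
    obtain ⟨V₂, hV₂, h₂, hw₂⟩ := ih₂ t' V₁ (hV.trans hV₁) h₁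
    exact ⟨_, (hV₁.trans hV₂).trans (Set.subset_insert _ _), h₂.add (hV₂ hw₁) hw₂,
      Set.mem_insert _ _⟩
  | neg w _ ih =>
    intro t' V' hV h
    obtain ⟨V₁, hV₁, h₁, hw₁⟩ := ih t' V' hV h
    obtain ⟨V₂, hV₂, h₂, hw₂⟩ := h0 t' V₁ (hV.trans hV₁) h₁
    refine ⟨_, (hV₁.trans hV₂).trans (Set.subset_insert _ _), h₂.sub hw₂ (hV₂ hw₁), ?_⟩
    left
    funext x
    simp

/-- Integral combinations are free. -/
theorem exists_of_mem_closure [Fintype κ] (h : FlowGraph t V) (hne : V.Nonempty)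
    (w : κ → (ι → ℝ) → ℝ) (hw : ∀ k, w k ∈ AddSubgroup.closure V) :
    ∃ V', V ⊆ V' ∧ FlowGraph t V' ∧ ∀ k, w k ∈ V' :=
  exists_forall (s := 0) (Q := fun k V => w k ∈ V) (fun _ _ _ h hk => h hk)
    (fun k t' V' hV h => exists_mem_of_mem_closure hne (hw k) t' V' hV h) h

theorem exists_mul [Fintype κ] (h : FlowGraph t V) (g : κ → ℝ) (u : κ → (ι → ℝ) → ℝ)
    (hu : ∀ k, u k ∈ V) :
    ∃ V', V ⊆ V' ∧ FlowGraph (t + Fintype.card κ) V' ∧ ∀ k, (fun x => g k * u k x) ∈ V' := by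
  simpa using exists_forall (s := 1) (Q := fun k V => (fun x => g k * u k x) ∈ V)
    (fun _ _ _ h hk => h hk)
    (fun k t' V' hV h => ⟨_, Set.subset_insert _ _, h.mul (g k) (hV (hu k)), Set.mem_insert _ _⟩) h

end FlowGraph

theorem ComputesWith.mul {μ κ ι : Type} [Fintype κ] [Fintype ι] {B : Matrix μ κ ℝ}
    {A : Matrix κ ι ℝ} {t s : ℕ} (hB : ComputesWith B s) (hA : ComputesWith A t) :
    ComputesWith (B * A) (t + s) := by
  obtain ⟨V, hV, hA⟩ := hA
  obtain ⟨W, hW, hB⟩ := hB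
  obtain ⟨V', -, h', hm⟩ := hW.exists_subst hV _ hA
  refine ⟨V', h', fun k => ?_⟩
  simpa [← Matrix.mulVec_mulVec] using hm _ (hB k)

theorem ComputesWith.submatrix_equiv {κ ι ι' : Type} [Fintype ι] [Fintype ι']
    {A : Matrix κ ι ℝ} {t : ℕ} (hA : ComputesWith A t) (e : ι' ≃ ι) :
    ComputesWith (A.submatrix id e) t := by
  obtain ⟨V, hV, hA⟩ := hA
  obtain ⟨V', -, h', hm⟩ := hV.exists_subst FlowGraph.input (fun k (x : ι' → ℝ) => x (e.symm k))
    (fun k => ⟨_, rfl⟩)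
  refine ⟨V', by simpa using h', fun k => ?_⟩
  have := hm _ (hA k)
  convert this using 2 with x
  rw [Matrix.submatrix_mulVec_equiv]
  rfl

theorem ComputesWith.one_kronecker {κ ι : Type} [Fintype κ] [Fintype ι] [DecidableEq κ]
    {A : Matrix ι ι ℝ} {t : ℕ} (hA : ComputesWith A t) :
    ComputesWith ((1 : Matrix κ κ ℝ) ⊗ₖ A) (Fintype.card κ * t) := by
  obtain ⟨V, hV, hA⟩ := hA
  obtain ⟨V', -, h', hm⟩ := FlowGraph.exists_forall (s := t) (κ := κ)
    (V := Set.range fun i x => x i)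
    (Q := fun k W => ∀ v ∈ V, (fun x : κ × ι → ℝ => v fun i => x (k, i)) ∈ W)
    (fun k _ _ h hk v hv => h (hk v hv))
    (fun k t' V' hV' h => hV.exists_subst h (fun i x => x (k, i)) fun i => hV' ⟨_, rfl⟩)
    FlowGraph.input
  refine ⟨V', by simpa using h', fun ⟨k, i⟩ => ?_⟩
  convert hm k _ (hA i) using 2 with x
  simp [Matrix.mulVec, dotProduct, Fintype.sum_prod_type, Matrix.kroneckerMap_apply,
    Matrix.one_apply]

theorem ComputesWith.kronecker_one {κ ι : Type} [Fintype κ] [Fintype ι] [DecidableEq κ]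
    {A : Matrix ι ι ℝ} {t : ℕ} (hA : ComputesWith A t) :
    ComputesWith (A ⊗ₖ (1 : Matrix κ κ ℝ)) (Fintype.card κ * t) := by
  obtain ⟨V, hV, hA⟩ := hA
  obtain ⟨V', -, h', hm⟩ := FlowGraph.exists_forall (s := t) (κ := κ)
    (V := Set.range fun i x => x i)
    (Q := fun k W => ∀ v ∈ V, (fun x : ι × κ → ℝ => v fun i => x (i, k)) ∈ W)
    (fun k _ _ h hk v hv => h (hk v hv))
    (fun k t' V' hV' h => hV.exists_subst h (fun i x => x (i, k)) fun i => hV' ⟨_, rfl⟩)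
    FlowGraph.input
  refine ⟨V', by simpa using h', fun ⟨i, k⟩ => ?_⟩
  convert hm k _ (hA i) using 2 with x
  simp [Matrix.mulVec, dotProduct, Fintype.sum_prod_type, Matrix.kroneckerMap_apply,
    Matrix.one_apply]

theorem exists_int_eq_mul {α : Type} [Finite α] (f : α → ℚ) :
    ∃ D : ℤ, D ≠ 0 ∧ ∃ z : α → ℤ, ∀ a, (z a : ℚ) = D * f a := by
  obtain ⟨b, hb⟩ := IsLocalization.exist_integer_multiples_of_finite (nonZeroDivisors ℤ) f
  choose z hz using hb
  exact ⟨b, nonZeroDivisors.coe_ne_zero b, z, fun a => by simpa [Algebra.smul_def] using hz a⟩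

/-- Rational rank bounds the number of multiplications, up to an integral factor that clears the
denominators. -/
theorem HasRationalRank.exists_computesWith {κ ι : Type} [Fintype κ] [Fintype ι] [Nonempty ι]
    {L : Matrix κ ι ℝ} {t : ℕ} (h : HasRationalRank L t) :
    ∃ D : ℝ, D ≠ 0 ∧ ComputesWith (D • L) t := by
  obtain ⟨R, g, c, a, h⟩ := h
  obtain ⟨D₁, hD₁, zR, hR⟩ := exists_int_eq_mul fun p : κ × ι => R p.1 p.2
  obtain ⟨D₂, hD₂, zc, hc⟩ := exists_int_eq_mul fun p : Fin t × κ => c p.1 p.2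
  obtain ⟨D₃, hD₃, za, ha⟩ := exists_int_eq_mul fun p : Fin t × ι => a p.1 p.2
  -- Only the denominators of the rational part scale the whole matrix; `D₂` and `D₃` are divided
  -- out inside the `t` real constants.
  refine ⟨D₁, by exact_mod_cast hD₁, ?_⟩
  have hne : (Set.range fun (i : ι) (x : ι → ℝ) => x i).Nonempty := Set.range_nonempty _
  have mem_sum : ∀ {V : Set ((ι → ℝ) → ℝ)} {μ : Type} [Fintype μ] (z : μ → ℤ)
      (u : μ → (ι → ℝ) → ℝ), (∀ i, u i ∈ V) →
      (fun x => ∑ i, (z i : ℝ) * u i x) ∈ AddSubgroup.closure V := by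
    intro V μ _ z u hu
    have : (fun x => ∑ i, (z i : ℝ) * u i x) = ∑ i, z i • u i := by
      funext x
      simp [Finset.sum_apply]
    rw [this]
    exact sum_mem fun i _ => zsmul_mem (AddSubgroup.subset_closure (hu i)) _
  obtain ⟨V₁, hV₁, h₁, hm₁⟩ := FlowGraph.exists_of_mem_closure FlowGraph.input hne
    (fun (r : Fin t) (x : ι → ℝ) => ∑ i, (za (r, i) : ℝ) * x i)
    (fun r => mem_sum _ _ fun i => ⟨i, rfl⟩)
  obtain ⟨V₂, hV₂, h₂, hm₂⟩ := h₁.exists_mul (fun r => D₁ * g r / (D₂ * D₃)) _ hm₁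
  obtain ⟨V₃, hV₃, h₃, hm₃⟩ := h₂.exists_of_mem_closure (hne.mono (hV₁.trans hV₂))
    (fun (k : κ) (x : ι → ℝ) => ∑ i, (zR (k, i) : ℝ) * x i +
      ∑ r, (zc (r, k) : ℝ) * (D₁ * g r / (D₂ * D₃) * ∑ i, (za (r, i) : ℝ) * x i))
    (fun k => add_mem (mem_sum _ _ fun i => hV₂ (hV₁ ⟨i, rfl⟩)) (mem_sum _ _ hm₂))
  refine ⟨V₃, by simpa using h₃, fun k => ?_⟩
  convert hm₃ k using 2 with x
  have hR' : ∀ i, (zR (k, i) : ℝ) = D₁ * R k i := fun i => by exact_mod_cast hR (k, i)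
  have hc' : ∀ r, (zc (r, k) : ℝ) = D₂ * c r k := fun r => by exact_mod_cast hc (r, k)
  have ha' : ∀ r i, (za (r, i) : ℝ) = D₃ * a r i := fun r i => by exact_mod_cast ha (r, i)
  have hD₂' : (D₂ : ℝ) ≠ 0 := by exact_mod_cast hD₂
  have hD₃' : (D₃ : ℝ) ≠ 0 := by exact_mod_cast hD₃
  simp only [Matrix.mulVec, dotProduct, Matrix.smul_apply, smul_eq_mul, h, hR', hc', ha',
    mul_add, add_mul, Finset.sum_add_distrib, Finset.mul_sum, Finset.sum_mul]
  congr 1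
  rw [Finset.sum_comm]
  refine Finset.sum_congr rfl fun r _ => Finset.sum_congr rfl fun i _ => ?_
  field_simp

/-! ### The prime factor index map -/

theorem exists_fin_odd_modEq (p : ℕ) (hp : 0 < p) (n : ℕ) : ∃ a : Fin p,
    (2 * (n : ℤ) + 1 ≡ 2 * ((a : ℕ) : ℤ) + 1 [ZMOD 4 * (p : ℤ)]) ∨
      (2 * (n : ℤ) + 1 ≡ -(2 * ((a : ℕ) : ℤ) + 1) [ZMOD 4 * (p : ℤ)]) := by
  have hd := Nat.div_add_mod n (2 * p)
  have hlt := Nat.mod_lt n (show 2 * p > 0 by omega)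
  have hd' : (n : ℤ) = 2 * p * (n / (2 * p) : ℕ) + (n % (2 * p) : ℕ) := by exact_mod_cast hd.symm
  by_cases h : n % (2 * p) < p
  -- The residue of `n` modulo `2 p` is kept if it is below `p` and otherwise reflected by `x ↦ 2 p
  -- - 1 - x`, which negates `2 x + 1` modulo `4 p`.
  · refine ⟨⟨_, h⟩, Or.inl (Int.modEq_iff_dvd.2 ⟨-(n / (2 * p) : ℕ), ?_⟩)⟩
    linear_combination -2 * hd'
  · refine ⟨⟨2 * p - 1 - n % (2 * p), by omega⟩,
      Or.inr (Int.modEq_iff_dvd.2 ⟨-(n / (2 * p) : ℕ) - 1, ?_⟩)⟩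
    have h2 : ((2 * p - 1 - n % (2 * p) : ℕ) : ℤ) = 2 * p - 1 - (n % (2 * p) : ℕ) := by omega
    rw [Fin.val_mk, h2]
    linear_combination -2 * hd'

theorem exists_isPrimeFactorMap {p q : ℕ} (hp : 0 < p) (hq : 0 < q) (hpq : Nat.Coprime p q) :
    ∃ e : Fin (q * p) ≃ Fin p × Fin q, IsPrimeFactorMap e := by
  choose a ha using fun n : Fin (q * p) => exists_fin_odd_modEq p hp n
  choose b hb using fun n : Fin (q * p) => exists_fin_odd_modEq q hq n
  have hinj : Function.Injective fun n => (a n, b n) := by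
    intro n n' h
    obtain ⟨h1, h2⟩ := Prod.mk.inj h
    have hcop : IsCoprime (p : ℤ) q := Nat.isCoprime_iff_coprime.2 hpq
    have sign : ∀ (r : ℕ) (c : Fin r),
        (2 * (n : ℤ) + 1 ≡ 2 * ((c : ℕ) : ℤ) + 1 [ZMOD 4 * (r : ℤ)] ∨
          2 * (n : ℤ) + 1 ≡ -(2 * ((c : ℕ) : ℤ) + 1) [ZMOD 4 * (r : ℤ)]) →
        (2 * (n' : ℤ) + 1 ≡ 2 * ((c : ℕ) : ℤ) + 1 [ZMOD 4 * (r : ℤ)] ∨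
          2 * (n' : ℤ) + 1 ≡ -(2 * ((c : ℕ) : ℤ) + 1) [ZMOD 4 * (r : ℤ)]) →
        (∃ z : ℤ, (n : ℤ) - n' = 2 * (r * z)) ∨ ∃ z : ℤ, (n : ℤ) + n' + 1 = 2 * (r * z) := by
      rintro r c (h | h) (h' | h') <;>
        obtain ⟨z, hz⟩ := Int.modEq_iff_dvd.1 h <;> obtain ⟨z', hz'⟩ := Int.modEq_iff_dvd.1 h'
      · exact Or.inl ⟨z' - z, by linarith⟩
      · exact Or.inr ⟨-z - z', by linarith⟩
      · exact Or.inr ⟨-z - z', by linarith⟩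
      · exact Or.inl ⟨z' - z, by linarith⟩
    have comb : ∀ x z z' : ℤ, x = 2 * (p * z) → x = 2 * (q * z') → ∃ w : ℤ, x = 2 * (q * p * w) := by
      intro x z z' h h'
      obtain ⟨w, hw⟩ := hcop.mul_dvd (Dvd.intro z rfl)
        (show (q : ℤ) ∣ p * z from ⟨z', by linarith⟩)
      exact ⟨w, by rw [h, hw]; ring⟩
    have hn := n.2
    have hn' := n'.2
    generalize hN : q * p = N at *
    have hN' : (q : ℤ) * p = N := by exact_mod_cast hN
    -- Since `n - n'` and `n + n' + 1` have opposite parities, the same one is even for both moduli,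
    -- and then it is a multiple of `2 q p`. The first has absolute value below `q p`, hence
    -- vanishes; the second lies strictly between `0` and `2 q p`, which is impossible.
    rcases sign p (a n) (ha n) (h1 ▸ ha n') with ⟨z, hz⟩ | ⟨z, hz⟩ <;>
      rcases sign q (b n) (hb n) (h2 ▸ hb n') with ⟨z', hz'⟩ | ⟨z', hz'⟩
    · obtain ⟨w, hw⟩ := comb _ _ _ hz hz'
      rw [hN'] at hw
      ext
      have : w = 0 := by
        by_contra hw0
        rcases lt_or_gt_of_ne hw0 with hlt | hlt <;> nlinarith
      rw [this] at hw
      omega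
    · exfalso
      omega
    · exfalso
      omega
    · exfalso
      obtain ⟨w, hw⟩ := comb _ _ _ hz hz'
      rw [hN'] at hw
      rcases le_or_gt w 0 with hlt | hlt <;> nlinarith
  exact ⟨Equiv.ofBijective _ ((Fintype.bijective_iff_injective_and_card _).2
    ⟨hinj, by simp [mul_comm]⟩), fun n => ⟨ha n, hb n⟩⟩

/-! ### The merging stage -/

theorem isScaledDCT2_of_diagonal {N : ℕ} {S : Matrix (Fin N) (Fin N) ℝ} (d : Fin N → ℝ)
    (h : ∀ k n, dct2 N k n = d k * S k n) : IsScaledDCT2 S := by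
  refine ⟨1, d, ?_⟩
  ext k n
  simp [h]

/-- The factors cannot vanish because column `0` of the DCT-II is positive; the merging constants
divide by them. -/
theorem IsScaledDCT2.exists_row {N : ℕ} {S : Matrix (Fin N) (Fin N) ℝ} (h : IsScaledDCT2 S) :
    ∃ (f : Fin N → Fin N) (c : Fin N → ℝ), (∀ k, c k ≠ 0) ∧
      ∀ k n, dct2 N k n = c k * S (f k) n := by
  obtain ⟨σ, d, h⟩ := h
  have hrow : ∀ k n, dct2 N k n = d (σ k) * S (σ k) n := by
    intro k n
    rw [h, Matrix.mul_assoc, PEquiv.toMatrix_toPEquiv_mul]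
    simp
  refine ⟨σ, fun k => d (σ k), fun k hk => ?_, hrow⟩
  have h0 := hrow k ⟨0, k.pos⟩
  rw [show d (σ k) = 0 from hk, zero_mul] at h0
  have := cos_dct2_phase_pos k
  rw [dct2, Matrix.of_apply] at h0
  refine this.ne' ?_
  rw [← h0]
  congr 1
  push_cast
  ring

theorem cos_eq_of_modEq {p : ℕ} (hp : 0 < p) {x y : ℤ}
    (h : x ≡ y [ZMOD 4 * (p : ℤ)] ∨ x ≡ -y [ZMOD 4 * (p : ℤ)]) (l : ℕ) :
    Real.cos (Real.pi * x * l / (2 * p)) = Real.cos (Real.pi * y * l / (2 * p)) := by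
  have hp' : (p : ℝ) ≠ 0 := by positivity
  have key : ∀ y : ℤ, x ≡ y [ZMOD 4 * (p : ℤ)] →
      Real.cos (Real.pi * x * l / (2 * p)) = Real.cos (Real.pi * y * l / (2 * p)) := by
    intro y h
    obtain ⟨z, hz⟩ := Int.modEq_iff_dvd.1 h
    obtain rfl : y = x + 4 * p * z := by linarith
    rw [← Real.cos_add_int_mul_two_pi _ (z * l)]
    congr 1
    push_cast
    field_simp
    ring
  rcases h with h | h
  · exact key y h
  · rw [key _ h, ← Real.cos_neg]
    congr 1
    push_cast
    ring

/-- Every output index of the prime factor algorithm is reduced to a sum or difference of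
multiples of the two lengths. -/
theorem exists_prime_factor_index {p q h : ℕ} (hp : 0 < p) (hq : q = 2 * h + 1)
    (hpq : Nat.Coprime p q) (K : ℤ) (hpK : ¬ (p : ℤ) ∣ K) (hqK : ¬ (q : ℤ) ∣ K) :
    ∃ (s : ℝ) (l k : ℕ) (ε : ℤ), 0 < l ∧ l < p ∧ 0 < k ∧ k ≤ h ∧ (ε = 1 ∨ ε = -1) ∧
      ∀ x : ℤ, Odd x → Real.cos (Real.pi * x * K / (2 * (q * p))) =
        s * Real.cos (Real.pi * x * l / (2 * p) + ε * (Real.pi * x * k / (2 * q))) := by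
  obtain ⟨a, b, hab⟩ := Nat.isCoprime_iff_coprime.2 hpq
  have hp' : (p : ℝ) ≠ 0 := by positivity
  have hq' : (q : ℝ) ≠ 0 := by
    have : 0 < q := by omega
    positivity
  -- The balanced residue modulo `q = 2 h + 1` gives `|v| ≤ h`, which halves the number of index
  -- pairs.
  obtain ⟨v, t, hvt, hv1, hv2⟩ : ∃ v t : ℤ, K * a = v + q * t ∧ -h ≤ v ∧ v ≤ h := by
    refine ⟨(K * a + h) % q - h, (K * a + h) / q, ?_, ?_, ?_⟩
    · have := Int.mul_ediv_add_emod (K * a + h) q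
      linarith
    · have := Int.emod_nonneg (K * a + h) (show (q : ℤ) ≠ 0 by omega)
      linarith
    · have := Int.emod_lt_of_pos (K * a + h) (show (0 : ℤ) < q by omega)
      omega
  -- Reduction is modulo `2 p`, not `p`: changing `K` by `2 p q z` only multiplies the cosine by
  -- `(-1) ^ z` for odd `x`.
  obtain ⟨u, z, huz, hu1, hu2⟩ : ∃ u z : ℤ, K * b + t * p = u + 2 * p * z ∧ -p ≤ u ∧ u < p := by
    refine ⟨(K * b + t * p + p) % (2 * p) - p, (K * b + t * p + p) / (2 * p), ?_, ?_, ?_⟩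
    · have := Int.mul_ediv_add_emod (K * b + t * p + p) (2 * p)
      linarith
    · have := Int.emod_nonneg (K * b + t * p + p) (show (2 * p : ℤ) ≠ 0 by omega)
      linarith
    · have := Int.emod_lt_of_pos (K * b + t * p + p) (show (0 : ℤ) < 2 * p by omega)
      omega
  have hK : K = u * q + v * p + 2 * p * q * z := by
    linear_combination -K * hab + p * hvt + q * huz
  have hu0 : u ≠ 0 := by
    rintro rfl
    exact hpK ⟨v + 2 * q * z, by rw [hK]; ring⟩
  have hup : u ≠ -p := by
    rintro rfl
    exact hpK ⟨-q + v + 2 * q * z, by rw [hK]; ring⟩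
  have hv0 : v ≠ 0 := by
    rintro rfl
    exact hqK ⟨u + 2 * p * z, by rw [hK]; ring⟩
  have hcos : ∀ x : ℤ, Odd x → Real.cos (Real.pi * x * K / (2 * (q * p))) =
      (-1) ^ z * Real.cos (Real.pi * x * u / (2 * p) + Real.pi * x * v / (2 * q)) := by
    intro x hx
    have h1 : Real.pi * x * K / (2 * (q * p)) =
        Real.pi * x * u / (2 * p) + Real.pi * x * v / (2 * q) + (x * z : ℤ) * Real.pi := by
      rw [hK]
      push_cast
      field_simp
    rw [h1, Real.cos_add_int_mul_pi, _root_.zpow_mul, hx.neg_one_zpow]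
  have final : ∀ ε : ℤ, (ε = 1 ∨ ε = -1) →
      (∀ x : ℝ, Real.cos (Real.pi * x * u / (2 * p) + Real.pi * x * v / (2 * q)) =
        Real.cos (Real.pi * x * u.natAbs / (2 * p) +
          ε * (Real.pi * x * v.natAbs / (2 * q)))) →
      ∃ (s : ℝ) (l k : ℕ) (ε : ℤ), 0 < l ∧ l < p ∧ 0 < k ∧ k ≤ h ∧ (ε = 1 ∨ ε = -1) ∧
      ∀ x : ℤ, Odd x → Real.cos (Real.pi * x * K / (2 * (q * p))) =
        s * Real.cos (Real.pi * x * l / (2 * p) + ε * (Real.pi * x * k / (2 * q))) :=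
    fun ε hε hx => ⟨(-1) ^ z, u.natAbs, v.natAbs, ε, by omega, by omega, by omega, by omega, hε,
      fun x hx' => by rw [hcos x hx', hx]⟩
  have cast_natAbs : ∀ y : ℤ, ((y.natAbs : ℕ) : ℝ) = ((y.natAbs : ℤ) : ℝ) := fun y => by simp
  rcases le_total 0 u with hu | hu <;> rcases le_total 0 v with hv | hv
  · refine final 1 (Or.inl rfl) fun x => ?_
    rw [cast_natAbs, cast_natAbs, Int.natAbs_of_nonneg hu, Int.natAbs_of_nonneg hv]
    simp
  · refine final (-1) (Or.inr rfl) fun x => ?_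
    rw [cast_natAbs, cast_natAbs, Int.natAbs_of_nonneg hu, Int.ofNat_natAbs_of_nonpos hv]
    congr 1
    push_cast
    ring
  · refine final (-1) (Or.inr rfl) fun x => ?_
    rw [cast_natAbs, cast_natAbs, Int.natAbs_of_nonneg hv, Int.ofNat_natAbs_of_nonpos hu,
      ← Real.cos_neg]
    congr 1
    push_cast
    ring
  · refine final 1 (Or.inl rfl) fun x => ?_
    rw [cast_natAbs, cast_natAbs, Int.ofNat_natAbs_of_nonpos hv, Int.ofNat_natAbs_of_nonpos hu,
      ← Real.cos_neg]
    congr 1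
    push_cast
    ring

/-- For odd `x`, `cos (π x / 2) = 0` and `sin (π x / 2) = ± 1`, so complementary frequencies turn
cosines into sines up to one common sign, which cancels in the product. Thus the sine term of the
addition formula is again a product of DCT-II entries. -/
theorem cos_add_eq_sub_complement {p q l k : ℕ} (hp : 0 < p) (hq : 0 < q) (hl : l ≤ p) (hk : k ≤ q)
    {ε x : ℤ} (hε : ε = 1 ∨ ε = -1) (hx : Odd x) :
    Real.cos (Real.pi * x * l / (2 * p) + ε * (Real.pi * x * k / (2 * q))) =
      Real.cos (Real.pi * x * l / (2 * p)) * Real.cos (Real.pi * x * k / (2 * q)) -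
      ε * (Real.cos (Real.pi * x * (p - l : ℕ) / (2 * p)) *
        Real.cos (Real.pi * x * (q - k : ℕ) / (2 * q))) := by
  have hp' : (p : ℝ) ≠ 0 := by positivity
  have hq' : (q : ℝ) ≠ 0 := by positivity
  have hcos : Real.cos (Real.pi * x / 2) = 0 := by
    obtain ⟨z, rfl⟩ := hx
    rw [Real.cos_eq_zero_iff]
    exact ⟨z, by push_cast; ring⟩
  have hsin := Real.sin_sq_add_cos_sq (Real.pi * x / 2)
  have h1 : Real.pi * x * (p - l : ℕ) / (2 * p) = Real.pi * x / 2 - Real.pi * x * l / (2 * p) := by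
    rw [Nat.cast_sub hl]
    field_simp
  have h2 : Real.pi * x * (q - k : ℕ) / (2 * q) = Real.pi * x / 2 - Real.pi * x * k / (2 * q) := by
    rw [Nat.cast_sub hk]
    field_simp
  rw [h1, h2, Real.cos_sub, Real.cos_sub, hcos, Real.cos_add]
  rw [hcos] at hsin
  rcases hε with rfl | rfl
  · push_cast
    rw [one_mul]
    linear_combination -Real.sin (Real.pi * x * l / (2 * p)) *
      Real.sin (Real.pi * x * k / (2 * q)) * (-hsin)
  · push_cast
    rw [neg_one_mul, Real.cos_neg, Real.sin_neg]
    linear_combination -Real.sin (Real.pi * x * l / (2 * p)) *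
      Real.sin (Real.pi * x * k / (2 * q)) * hsin

section Merge

variable {κ ι ρ : Type} [Fintype κ] [Fintype ι] [DecidableEq ι] [Fintype ρ]

/-- A matrix each row of which is a unit vector or of the form `e_{u r} ± γ r e_{w r}` is computed
with one multiplication for each `r`. -/
theorem computesWith_of_rows [Nonempty ι] (M : Matrix κ ι ℝ) (u w : ρ → ι) (γ : ρ → ℝ)
    (hM : ∀ k, (∃ i, M k = Pi.single i 1) ∨
      ∃ (r : ρ) (ε : ℤ), M k = Pi.single (u r) 1 + Pi.single (w r) (ε * γ r)) :
    ComputesWith M (Fintype.card ρ) := by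
  obtain ⟨V₁, hV₁, h₁, hm₁⟩ := FlowGraph.input.exists_mul γ
    (fun r (x : ι → ℝ) => x (w r)) fun r => ⟨_, rfl⟩
  have hin : ∀ i, (fun x : ι → ℝ => x i) ∈ V₁ := fun i => hV₁ ⟨i, rfl⟩
  obtain ⟨V₂, -, h₂, hm₂⟩ := h₁.exists_of_mem_closure ⟨_, hin (Classical.arbitrary ι)⟩
    (fun k x => (M *ᵥ x) k) fun k => by
      rcases hM k with ⟨i, hi⟩ | ⟨r, ε, hr⟩
      · convert AddSubgroup.subset_closure (hin i) using 2 with x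
        simp [Matrix.mulVec, hi]
      -- The integer `ε` is free, so all rows with the same `r` share the product with `γ r`.
      · convert add_mem (AddSubgroup.subset_closure (hin (u r)))
          (zsmul_mem (AddSubgroup.subset_closure (hm₁ r)) ε) using 1
        funext x
        change M k ⬝ᵥ x = _
        rw [hr, add_dotProduct]
        simp [mul_assoc]
  exact ⟨V₂, by simpa using h₂, hm₂⟩

end Merge

/-- The last stage of the prime factor algorithm. -/
theorem exists_merge {p h : ℕ} (hp : 0 < p) (hpq : Nat.Coprime p (2 * h + 1))
    {e : Fin ((2 * h + 1) * p) ≃ Fin p × Fin (2 * h + 1)} (he : IsPrimeFactorMap e)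
    {Sp : Matrix (Fin p) (Fin p) ℝ} (hSp : IsScaledDCT2 Sp)
    {Sq : Matrix (Fin (2 * h + 1)) (Fin (2 * h + 1)) ℝ} (hSq : IsScaledDCT2 Sq) :
    ∃ M : Matrix (Fin ((2 * h + 1) * p)) (Fin p × Fin (2 * h + 1)) ℝ,
      ComputesWith M ((p - 1) * h) ∧ IsScaledDCT2 ((M *
        ((Sp ⊗ₖ (1 : Matrix (Fin (2 * h + 1)) (Fin (2 * h + 1)) ℝ)) *
          ((1 : Matrix (Fin p) (Fin p) ℝ) ⊗ₖ Sq))).submatrix id e) := by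
  obtain ⟨f, β, hβ, hf⟩ := hSp.exists_row
  obtain ⟨g, α, hα, hg⟩ := hSq.exists_row
  have hp' : (p : ℝ) ≠ 0 := by positivity
  rw [← Matrix.mul_kronecker_mul, Matrix.one_mul, Matrix.mul_one]
  have hcosp : ∀ (n : Fin ((2 * h + 1) * p)) (l : Fin p),
      Real.cos (Real.pi * (2 * (n : ℕ) + 1 : ℤ) * (l : ℕ) / (2 * p)) =
        β l * Sp (f l) (e n).1 := by
    intro n l
    rw [cos_eq_of_modEq hp (he n).1, ← hf, dct2, Matrix.of_apply]
    push_cast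
    rfl
  have hcosq : ∀ (n : Fin ((2 * h + 1) * p)) (k : Fin (2 * h + 1)),
      Real.cos (Real.pi * (2 * (n : ℕ) + 1 : ℤ) * (k : ℕ) / (2 * (2 * h + 1 : ℕ))) =
        α k * Sq (g k) (e n).2 := by
    intro n k
    rw [cos_eq_of_modEq (by omega) (he n).2, ← hg, dct2, Matrix.of_apply]
    push_cast
    rfl
  let l₁ : Fin (p - 1) × Fin h → Fin p := fun r => ⟨r.1 + 1, by omega⟩
  let l₂ : Fin (p - 1) × Fin h → Fin p := fun r => ⟨p - (r.1 + 1), by omega⟩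
  let k₁ : Fin (p - 1) × Fin h → Fin (2 * h + 1) := fun r => ⟨r.2 + 1, by omega⟩
  let k₂ : Fin (p - 1) × Fin h → Fin (2 * h + 1) := fun r => ⟨2 * h + 1 - (r.2 + 1), by omega⟩
  -- The scale of the first product is moved into the diagonal matrix, so a single ratio remains on
  -- the complementary product.
  let γ : Fin (p - 1) × Fin h → ℝ := fun r =>
    β (l₂ r) * α (k₂ r) / (β (l₁ r) * α (k₁ r))
  have rows : ∀ K : Fin ((2 * h + 1) * p), ∃ (d : ℝ) (row : Fin p × Fin (2 * h + 1) → ℝ),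
      (∀ n, dct2 ((2 * h + 1) * p) K n =
        d * ∑ x, row x * (Sp x.1 (e n).1 * Sq x.2 (e n).2)) ∧
      ((∃ i, row = Pi.single i 1) ∨ ∃ (r : Fin (p - 1) × Fin h) (ε : ℤ),
        row = Pi.single (f (l₁ r), g (k₁ r)) 1 + Pi.single (f (l₂ r), g (k₂ r)) (ε * γ r)) := by
    intro K
    have prod_row : ∀ (l : Fin p) (k : Fin (2 * h + 1)),
        (∀ n, dct2 ((2 * h + 1) * p) K n = (β l * Sp (f l) (e n).1) * (α k * Sq (g k) (e n).2)) →
        ∃ (d : ℝ) (row : Fin p × Fin (2 * h + 1) → ℝ),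
          (∀ n, dct2 ((2 * h + 1) * p) K n =
            d * ∑ x, row x * (Sp x.1 (e n).1 * Sq x.2 (e n).2)) ∧
          ((∃ i, row = Pi.single i 1) ∨ ∃ (r : Fin (p - 1) × Fin h) (ε : ℤ),
            row = Pi.single (f (l₁ r), g (k₁ r)) 1 +
              Pi.single (f (l₂ r), g (k₂ r)) (ε * γ r)) := by
      intro l k hlk
      refine ⟨β l * α k, Pi.single (f l, g k) 1, fun n => ?_, Or.inl ⟨_, rfl⟩⟩
      rw [hlk]
      simp [Pi.single_apply]
      ring
    by_cases hpK : p ∣ (K : ℕ)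
    · obtain ⟨k, hk⟩ := hpK
      have hkq : k < 2 * h + 1 := by
        have := K.2
        rw [hk, mul_comm] at this
        exact lt_of_mul_lt_mul_right this (Nat.zero_le _)
      -- For `K = p k` the output is the length-`q` cosine of frequency `k`; the other factor has
      -- frequency `0`.
      refine prod_row ⟨0, hp⟩ ⟨k, hkq⟩ fun n => ?_
      rw [← hcosp, ← hcosq, dct2, Matrix.of_apply, hk]
      simp only [Nat.cast_zero, mul_zero, zero_div, Real.cos_zero, one_mul]
      congr 1
      push_cast
      field_simp
    by_cases hqK : 2 * h + 1 ∣ (K : ℕ)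
    · obtain ⟨l, hl⟩ := hqK
      have hlp : l < p := by
        have := K.2
        rw [hl] at this
        exact lt_of_mul_lt_mul_left this (Nat.zero_le _)
      refine prod_row ⟨l, hlp⟩ ⟨0, by omega⟩ fun n => ?_
      rw [← hcosp, ← hcosq, dct2, Matrix.of_apply, hl]
      simp only [Nat.cast_zero, mul_zero, zero_div, Real.cos_zero, mul_one]
      congr 1
      push_cast
      field_simp
    obtain ⟨s, l, k, ε, hl0, hlp, hk0, hkh, hε, hs⟩ := exists_prime_factor_index hp rfl hpq K
      (by exact_mod_cast hpK) (by exact_mod_cast hqK)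
    obtain ⟨r, hr1, hr2⟩ : ∃ r : Fin (p - 1) × Fin h, (r.1 : ℕ) + 1 = l ∧ (r.2 : ℕ) + 1 = k :=
      ⟨(⟨l - 1, by omega⟩, ⟨k - 1, by omega⟩), by simp; omega, by simp; omega⟩
    refine ⟨s * (β (l₁ r) * α (k₁ r)), _, fun n => ?_, Or.inr ⟨r, -ε, rfl⟩⟩
    have hX : dct2 ((2 * h + 1) * p) K n = s * (β (l₁ r) * Sp (f (l₁ r)) (e n).1 *
        (α (k₁ r) * Sq (g (k₁ r)) (e n).2) - ε * (β (l₂ r) * Sp (f (l₂ r)) (e n).1 *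
          (α (k₂ r) * Sq (g (k₂ r)) (e n).2))) := by
      rw [← hcosp, ← hcosp, ← hcosq, ← hcosq]
      simp only [l₁, l₂, k₁, k₂, hr1, hr2]
      rw [← cos_add_eq_sub_complement hp (by omega) hlp.le (by omega) hε ⟨_, rfl⟩,
        ← hs _ ⟨_, rfl⟩, dct2, Matrix.of_apply]
      congr 1
      push_cast
      ring
    rw [hX]
    have hβ₁ := hβ (l₁ r)
    have hα₁ := hα (k₁ r)
    simp only [Pi.add_apply, add_mul, Finset.sum_add_distrib, Pi.single_apply, ite_mul, zero_mul,
      one_mul, Finset.sum_ite_eq', Finset.mem_univ, if_true, γ]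
    push_cast
    field_simp
    ring
  choose d row hd hrow using rows
  refine ⟨Matrix.of row, ?_, isScaledDCT2_of_diagonal d fun K n => ?_⟩
  · have : Nonempty (Fin p × Fin (2 * h + 1)) := ⟨(⟨0, hp⟩, 0)⟩
    simpa using computesWith_of_rows (Matrix.of row) (fun r => (f (l₁ r), g (k₁ r)))
      (fun r => (f (l₂ r), g (k₂ r))) γ hrow
  · rw [hd]
    simp [Matrix.mul_apply, Matrix.kroneckerMap_apply]

/-! ### Assembling the count -/

theorem ScaledPFA.UsesMul.computesWith {q p s t : ℕ} {A : ScaledPFA q p} (h : A.UsesMul s t) :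
    ComputesWith A.matrix t := by
  obtain ⟨a, c, hs, ha, hc, rfl⟩ := h
  simpa [ScaledPFA.matrix] using (hc.mul ((ha.kronecker_one (κ := Fin q)).mul
    (hs.one_kronecker (κ := Fin p)))).submatrix_equiv A.split

/-- The scaled DCT-II of length `2 ^ m` has a flow graph with few multiplications
(Feig-Winograd). -/
theorem exists_isScaledDCT2_two_pow (m : ℕ) : ∃ S : Matrix (Fin (2 ^ m)) (Fin (2 ^ m)) ℝ,
    IsScaledDCT2 S ∧ ComputesWith S (scaledDCT2Rank m) := by
  obtain ⟨S, ⟨d, hd⟩, hS⟩ := exists_isScaledDCT2_hasRationalRank m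
  obtain ⟨D, hD, h⟩ := hS.exists_computesWith
  refine ⟨D • S, isScaledDCT2_of_diagonal (fun k => d k / D) fun k n => ?_, h⟩
  rw [hd, Matrix.smul_apply, smul_eq_mul]
  field_simp

theorem exists_scaledPFA (q m : ℕ) (hq : Odd q) (Sq : Matrix (Fin q) (Fin q) ℝ) (s : ℕ)
    (hSq : IsScaledDCT2 Sq) (hs : ComputesWith Sq s) :
    ∃ (A : ScaledPFA q (2 ^ m)) (t : ℕ), A.Sq = Sq ∧ A.UsesMul s t ∧ ComputesWith A.matrix t ∧
      (t : ℝ) ≤ 2 ^ m * (s : ℝ) + 5 / 2 * ((q * 2 ^ m : ℕ) : ℝ)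
        - (q : ℝ) * (((m : ℝ) * ((m : ℝ) + 3) + 5) / 2)
        - (2 : ℝ) ^ ((m : ℤ) - 1) + 1 / 2 := by
  obtain ⟨h, rfl⟩ := hq
  have hp : 0 < 2 ^ m := by positivity
  have hpq : Nat.Coprime (2 ^ m) (2 * h + 1) := by
    apply Nat.Coprime.pow_left
    simp
  obtain ⟨e, he⟩ := exists_isPrimeFactorMap hp (show 0 < 2 * h + 1 by omega) hpq
  obtain ⟨Sp, hSp, ha⟩ := exists_isScaledDCT2_two_pow m
  obtain ⟨M, hM, hres⟩ := exists_merge hp hpq he hSp hSq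
  let A : ScaledPFA (2 * h + 1) (2 ^ m) := ⟨e, he, Sq, hSq, Sp, hSp, M, hres⟩
  have hA : A.UsesMul s (2 ^ m * s + (2 * h + 1) * scaledDCT2Rank m + (2 ^ m - 1) * h) :=
    ⟨_, _, hs, ha, hM, rfl⟩
  -- The count of this construction equals the stated bound, with `h = (q - 1) / 2`.
  refine ⟨A, _, rfl, hA, hA.computesWith, le_of_eq ?_⟩
  rw [zpow_sub_one₀ two_ne_zero, zpow_natCast]
  push_cast [Nat.cast_sub Nat.one_le_two_pow, scaledDCT2Rank_eq]
  ring

theorem proposition3 (q m : ℕ) (hq : Odd q) :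
    (∀ (Sq : Matrix (Fin q) (Fin q) ℝ) (s : ℕ), IsScaledDCT2 Sq → ComputesWith Sq s →
      ∃ (A : ScaledPFA q (2 ^ m)) (t : ℕ),
        A.Sq = Sq ∧ A.UsesMul s t ∧ ComputesWith A.matrix t ∧
        (t : ℝ) ≤ 2 ^ m * (s : ℝ) + 5 / 2 * ((q * 2 ^ m : ℕ) : ℝ)
          - (q : ℝ) * (((m : ℝ) * ((m : ℝ) + 3) + 5) / 2)
          - (2 : ℝ) ^ ((m : ℤ) - 1) + 1 / 2) ∧
    (scaledMulComplexity (q * 2 ^ m) : ℝ) ≤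
      2 ^ m * (scaledMulComplexity q : ℝ) + 5 / 2 * ((q * 2 ^ m : ℕ) : ℝ)
        - (q : ℝ) * (((m : ℝ) * ((m : ℝ) + 3) + 5) / 2)
        - (2 : ℝ) ^ ((m : ℤ) - 1) + 1 / 2 := by

  refine ⟨exists_scaledPFA q m hq, ?_⟩
  obtain ⟨S, hS, hs⟩ := scaledMulComplexity_spec q hq.pos
  obtain ⟨A, t, -, -, hA, ht⟩ := exists_scaledPFA q m hq S _ hS hs
  have hle : scaledMulComplexity (q * 2 ^ m) ≤ t := Nat.sInf_le ⟨A.matrix, A.result_scaled, hA⟩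
  exact (Nat.cast_le.2 hle).trans ht
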